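/- **Theorem (diagonal of the Laplacian pseudoinverse of Koch networks).** Let $\mathcal K_0$ be a triangle and, for $g\ge 1$, let $\mathcal K_g$ be obtained from $\mathcal K_{g-1}$ as follows: for every triangle of $\mathcal K_{g-1}$ and each of its three nodes $v$, create two new nodes and join these two and $v$ to one another, forming a new triangle. The three nodes of $\mathcal K_0$ have level $0$ and are called hubs; a node created at iteration $k\ge1$ has level $k$. A node $x$ of $\mathcal K_g$ has label $\{i_0,i_1,\dots,i_n\}$ if $v_0-v_1-\cdots-v_n=x$ is a shortest path from a nearest hub $v_0$ to $x$ and $i_k$ is the level of $v_k$ (so $i_0=0$). Let $\mathbf L^\dagger(g)$ be the Moore–Penrose pseudoinverse of the Laplacian matrix of $\mathcal K_g$. Then for every $g\ge 0$ and every node $x$ of $\mathcal K_g$ with label $\{i_0,i_1,\dots,i_n\}$, $$\mathbf L^\dagger_{xx}(g)=\frac{2}{3(2\cdot 4^g+1)}\Bigl(2n\cdot 4^g-\sum_{k=1}^{n}2\cdot 4^{\,g-i_k}\Bigr)+\frac{2^{2g+1}\,(5\cdot 4^g+3g+4)}{9\,(2\cdot 4^g+1)^2}.$$ -/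

import Mathlib

section PseudoInverse

/-- The four Penrose equations, for real square matrices. -/
structure IsMoorePenroseInverse {ι : Type*} [Fintype ι] (A P : Matrix ι ι ℝ) : Prop where
  mul_mul_left : A * P * A = A
  mul_mul_right : P * A * P = P
  transpose_left : (A * P).transpose = A * P
  transpose_right : (P * A).transpose = P * A

theorem IsMoorePenroseInverse.unique {ι : Type*} [Fintype ι] {A P Q : Matrix ι ι ℝ}
    (hP : IsMoorePenroseInverse A P) (hQ : IsMoorePenroseInverse A Q) : P = Q := by
  have h1 : A * P = A * Q := by
    calc A * P = (A * P).transpose := hP.transpose_left.symm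
      _ = ((A * Q) * (A * P)).transpose := by
          rw [← Matrix.mul_assoc, hQ.mul_mul_left]
      _ = (A * P).transpose * (A * Q).transpose := Matrix.transpose_mul _ _
      _ = A * P * (A * Q) := by rw [hP.transpose_left, hQ.transpose_left]
      _ = A * Q := by rw [← Matrix.mul_assoc, hP.mul_mul_left]
  have h2 : P * A = Q * A := by
    calc P * A = (P * A).transpose := hP.transpose_right.symm
      _ = ((P * A) * (Q * A)).transpose := by
          rw [Matrix.mul_assoc P A, ← Matrix.mul_assoc A Q A, hQ.mul_mul_left]
      _ = (Q * A).transpose * (P * A).transpose := Matrix.transpose_mul _ _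
      _ = Q * A * (P * A) := by rw [hP.transpose_right, hQ.transpose_right]
      _ = Q * A := by rw [Matrix.mul_assoc, ← Matrix.mul_assoc A P A, hP.mul_mul_left]
  calc P = P * A * P := hP.mul_mul_right.symm
    _ = Q * (A * P) := by rw [h2, Matrix.mul_assoc]
    _ = Q * A * Q := by rw [h1, Matrix.mul_assoc]
    _ = Q := hQ.mul_mul_right

theorem exists_isMoorePenroseInverse {ι : Type*} [Fintype ι] [DecidableEq ι]
    {A : Matrix ι ι ℝ} (hA : A.IsHermitian) : ∃ P, IsMoorePenroseInverse A P := by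
  set U : Matrix ι ι ℝ := (hA.eigenvectorUnitary : Matrix ι ι ℝ)
  set d : ι → ℝ := hA.eigenvalues
  have hU : U.transpose * U = 1 := by
    have := Unitary.coe_star_mul_self hA.eigenvectorUnitary
    simpa [Matrix.star_eq_conjTranspose] using this
  have hAeq : A = U * Matrix.diagonal d * U.transpose := by
    have := hA.spectral_theorem
    simpa [Unitary.conjStarAlgAut_apply, Matrix.star_eq_conjTranspose, Function.comp_def]
      using this
  have key : ∀ a b : ι → ℝ, (U * Matrix.diagonal a * U.transpose) *
      (U * Matrix.diagonal b * U.transpose) =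
        U * Matrix.diagonal (fun i => a i * b i) * U.transpose := by
    intro a b
    calc _ = U * Matrix.diagonal a * (U.transpose * U) * Matrix.diagonal b * U.transpose := by
          simp only [Matrix.mul_assoc]
      _ = _ := by
          rw [hU, Matrix.mul_one, Matrix.mul_assoc U, Matrix.diagonal_mul_diagonal]
  have symm : ∀ a : ι → ℝ, (U * Matrix.diagonal a * U.transpose).transpose =
      U * Matrix.diagonal a * U.transpose := by
    intro a
    simp [Matrix.transpose_mul, Matrix.mul_assoc]
  refine ⟨U * Matrix.diagonal (fun i => (d i)⁻¹) * U.transpose, ?_, ?_, ?_, ?_⟩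
  · rw [hAeq, key, key]; congr 3; ext i; exact mul_inv_mul_cancel (d i)
  · rw [hAeq, key, key]; congr 3; ext i; simpa using mul_inv_mul_cancel (d i)⁻¹
  · rw [hAeq, key, symm]
  · rw [hAeq, key, symm]

/-- The Moore–Penrose pseudoinverse of a real symmetric matrix. -/
noncomputable def pseudoInverse {ι : Type*} [Fintype ι] [DecidableEq ι]
    (A : Matrix ι ι ℝ) (hA : A.IsHermitian) : Matrix ι ι ℝ :=
  (exists_isMoorePenroseInverse hA).choose

theorem pseudoInverse_spec {ι : Type*} [Fintype ι] [DecidableEq ι]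
    (A : Matrix ι ι ℝ) (hA : A.IsHermitian) :
    IsMoorePenroseInverse A (pseudoInverse A hA) :=
  (exists_isMoorePenroseInverse hA).choose_spec

end PseudoInverse

section Koch

/-- A triangle of `G` (a clique on three vertices) together with one of its three vertices. -/
def PointedTriangle {V : Type} (G : SimpleGraph V) : Type :=
  {p : Finset V × V // G.IsNClique 3 p.1 ∧ p.2 ∈ p.1}

/-- The marked vertex of a pointed triangle. -/
def PointedTriangle.mother {V : Type} {G : SimpleGraph V} (t : PointedTriangle G) : V :=
  t.1.2

instance {V : Type} [Finite V] (G : SimpleGraph V) : Finite (PointedTriangle G) :=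
  inferInstanceAs
    (Finite {p : Finset V × V // G.IsNClique 3 p.1 ∧ p.2 ∈ p.1})

/-- Adjacency after one iteration: for every triangle of `G` and every vertex of that triangle
there are two new vertices, indexed by `Bool`, which form a new triangle with their mother. -/
def kochStepAdj {V : Type} (G : SimpleGraph V) :
    V ⊕ (PointedTriangle G × Bool) → V ⊕ (PointedTriangle G × Bool) → Prop
  | .inl u, .inl v => G.Adj u v
  | .inl u, .inr (t, _) => u = t.mother
  | .inr (t, _), .inl u => u = t.mother
  | .inr (t, b), .inr (t', b') => t = t' ∧ b ≠ b'

/-- The graph obtained from `G` by one iteration of the Koch construction. -/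
def kochStep {V : Type} (G : SimpleGraph V) : SimpleGraph (V ⊕ (PointedTriangle G × Bool)) where
  Adj := kochStepAdj G
  symm := ⟨by
    rintro (u | ⟨t, b⟩) (v | ⟨t', b'⟩) h
    · exact SimpleGraph.Adj.symm (G := G) h
    · exact h
    · exact h
    · exact ⟨h.1.symm, h.2.symm⟩⟩
  loopless := ⟨by
    rintro (u | ⟨t, b⟩) h
    · exact G.loopless.irrefl u h
    · exact h.2 rfl⟩

/-- A finite simple graph, bundled with its vertex type. -/
structure FiniteGraph where
  V : Type
  finite : Finite V
  graph : SimpleGraph V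

/-- The Koch network after `g` iterations, starting from a triangle. -/
def kochNetwork : ℕ → FiniteGraph
  | 0 => ⟨Fin 3, inferInstance, ⊤⟩
  | g + 1 =>
    haveI := (kochNetwork g).finite
    ⟨(kochNetwork g).V ⊕ (PointedTriangle (kochNetwork g).graph × Bool), inferInstance,
      kochStep (kochNetwork g).graph⟩

/-- The nodes of the Koch network after `g` iterations. -/
abbrev KochNode (g : ℕ) : Type := (kochNetwork g).V

/-- The Koch network after `g` iterations, as a graph on its nodes. -/
abbrev kochGraph (g : ℕ) : SimpleGraph (KochNode g) := (kochNetwork g).graph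

noncomputable instance (g : ℕ) : Fintype (KochNode g) :=
  haveI := (kochNetwork g).finite
  Fintype.ofFinite _

/-- The level of a node: the iteration at which it was created. -/
def kochLevel : (g : ℕ) → KochNode g → ℕ
  | 0, _ => 0
  | g + 1, x => Sum.elim (kochLevel g) (fun _ => g + 1) x

/-- `i` is a label of the node `x`: there is a path `v₀ - v₁ - ⋯ - vₙ = x` from a hub `v₀`
(a node of level `0`) that is shortest among all walks from hubs to `x`,
and `i k` is the level of `v_k`. -/
def IsKochLabel (g : ℕ) (x : KochNode g) {n : ℕ} (i : Fin (n + 1) → ℕ) : Prop :=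
  ∃ (h : KochNode g) (p : (kochGraph g).Walk h x),
    kochLevel g h = 0 ∧ p.length = n ∧
    (∀ (h' : KochNode g) (q : (kochGraph g).Walk h' x), kochLevel g h' = 0 → n ≤ q.length) ∧
    ∀ k : Fin (n + 1), kochLevel g (p.getVert k) = i k

/-- Every node of a Koch network has a label. -/
theorem exists_isKochLabel (g : ℕ) (x : KochNode g) :
    ∃ (n : ℕ) (i : Fin (n + 1) → ℕ), IsKochLabel g x i := by
  classical
  have hwalk : ∀ (g : ℕ) (x : KochNode g),
      ∃ (h : KochNode g), kochLevel g h = 0 ∧ (kochGraph g).Reachable h x := by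
    intro g
    induction g with
    | zero => exact fun x => ⟨x, rfl, SimpleGraph.Reachable.refl x⟩
    | succ g ih =>
      let f : kochGraph g →g kochGraph (g + 1) := ⟨Sum.inl, fun {_ _} h => h⟩
      rintro (u | ⟨t, b⟩)
      · obtain ⟨h, h0, hr⟩ := ih u
        exact ⟨Sum.inl h, h0, hr.map f⟩
      · obtain ⟨h, h0, hr⟩ := ih t.mother
        have hadj : (kochGraph (g + 1)).Adj (Sum.inl t.mother) (Sum.inr (t, b)) :=
          (rfl : t.mother = t.mother)
        exact ⟨Sum.inl h, h0, (hr.map f).trans hadj.reachable⟩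
  have hex : ∃ m : ℕ, ∃ (h : KochNode g) (p : (kochGraph g).Walk h x),
      kochLevel g h = 0 ∧ p.length = m := by
    obtain ⟨h, h0, ⟨p⟩⟩ := hwalk g x
    exact ⟨_, h, p, h0, rfl⟩
  obtain ⟨h, p, h0, hp⟩ := Nat.find_spec hex
  exact ⟨Nat.find hex, fun k => kochLevel g (p.getVert k), h, p, h0, hp,
    fun h' q hq => Nat.find_min' hex ⟨h', q, hq, rfl⟩, fun _ => rfl⟩

open Classical in
/-- The pseudoinverse of the Laplacian matrix of the Koch network after `g` iterations. -/
noncomputable def kochLapPinv (g : ℕ) : Matrix (KochNode g) (KochNode g) ℝ :=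
  pseudoInverse ((kochGraph g).lapMatrix ℝ) ((kochGraph g).isHermitian_lapMatrix ℝ)

end Koch

/-! Every block of a Koch network is a triangle. For x ≠ y exactly one triangle at x leads toward y:
one of its other vertices is nearer to y by 1, the other is equally far. All remaining neighbours of
x are farther by 1. Hence L D = a 1ᵀ - 3 I for the distance matrix D, with a = 3 - degree
(`IsTriangularDist.kochStep`), so doubly centring -D / 3 gives the pseudoinverse of L
(`IsMoorePenroseInverse.diag_eq_of_mul_eq`). Only this identity is needed of `kochDist`, not that it
is the graph metric.

The diagonal thus reduces to row sums of D, which are those of a hub plus `kochExcess`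
(`sum_kochDist`). A node of level i exceeds its mother by 2·4^g - 2·4^(g-i), and a shortest path
from the hubs passes from mother to child at every step, so these increments telescope to the label
formula. -/

/-! ### Pseudoinverse from a distance-like matrix -/

open Matrix in
/-- If `L` is symmetric with zero row sums and `L * D = a 1ᵀ - 3 I`, the pseudoinverse of `L` is
the doubly centred matrix `-D / 3`; this is its diagonal. -/
theorem IsMoorePenroseInverse.diag_eq_of_mul_eq {ι : Type*} [Fintype ι] [DecidableEq ι]
    {L D P : Matrix ι ι ℝ} {a : ι → ℝ} (hP : IsMoorePenroseInverse L P)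
    (hL : Lᵀ = L) (hL1 : ∀ x, ∑ y, L x y = 0) (hD : Dᵀ = D)
    (hLD : ∀ x y, (L * D) x y = a x - if x = y then 3 else 0) (x : ι) (hx : D x x = 0) :
    P x x = 2 / (3 * (Fintype.card ι : ℝ)) * ∑ y, D x y -
      (∑ z, ∑ y, D z y) / (3 * (Fintype.card ι : ℝ) ^ 2) := by
  have hN : (Fintype.card ι : ℝ) ≠ 0 := by
    have : Nonempty ι := ⟨x⟩
    exact Nat.cast_ne_zero.2 Fintype.card_ne_zero
  set N : ℝ := (Fintype.card ι : ℝ) with hNdef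
  set J : Matrix ι ι ℝ := Matrix.of fun _ _ => 1 with hJ
  -- Orthogonal projection onto the complement of the constants.
  set Q : Matrix ι ι ℝ := 1 - N⁻¹ • J with hQ
  have hJJ : J * J = N • J := by
    ext i j; simp [hJ, Matrix.mul_apply, hNdef]
  have hJQ : J * Q = 0 := by
    rw [hQ, Matrix.mul_sub, Matrix.mul_smul, hJJ, smul_smul, inv_mul_cancel₀ hN]; simp
  have hQQ : Q * Q = Q := by
    nth_rewrite 1 [hQ]
    rw [Matrix.sub_mul, Matrix.smul_mul, hJQ]; simp
  have hJT : Jᵀ = J := by ext i j; simp [hJ]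
  have hQT : Qᵀ = Q := by simp [hQ, Matrix.transpose_sub, Matrix.transpose_smul, hJT]
  have hLJ : L * J = 0 := by
    ext i j; simp [hJ, Matrix.mul_apply, hL1]
  have hLQ : L * Q = L := by
    rw [hQ, Matrix.mul_sub, Matrix.mul_smul, hLJ]; simp
  have hLD' : L * D = Matrix.diagonal a * J - (3 : ℝ) • (1 : Matrix ι ι ℝ) := by
    ext i j
    rw [hLD]
    simp [hJ, Matrix.diagonal_mul, Matrix.one_apply]
  set M : Matrix ι ι ℝ := (-(1 / 3 : ℝ)) • (Q * D * Q) with hM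
  have hMT : Mᵀ = M := by
    simp only [hM, Matrix.transpose_smul, Matrix.transpose_mul, hQT, hD, Matrix.mul_assoc]
  -- L absorbs the left Q, and the right Q kills a 1ᵀ, leaving the -3 I term.
  have hLM : L * M = Q := by
    rw [hM, Matrix.mul_smul, ← Matrix.mul_assoc, ← Matrix.mul_assoc, hLQ, hLD', Matrix.sub_mul,
      Matrix.mul_assoc, hJQ, Matrix.mul_zero, Matrix.smul_mul, Matrix.one_mul, zero_sub, smul_neg,
      smul_smul]
    norm_num
  have hML : M * L = Q := by
    rw [← hQT, ← hLM, Matrix.transpose_mul, hMT, hL]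
  have hQM : Q * M = M := by
    rw [hM, Matrix.mul_smul, ← Matrix.mul_assoc, ← Matrix.mul_assoc, hQQ]
  have hQL : Q * L = L := by
    rw [← hL, ← hQT, ← Matrix.transpose_mul, hLQ]
  have hPM : P = M := hP.unique
    ⟨by rw [hLM, hQL], by rw [hML, hQM], by rw [hLM, hQT], by rw [hML, hQT]⟩
  have hS : ∑ y, D y x = ∑ y, D x y :=
    Finset.sum_congr rfl fun y _ => congrFun (congrFun hD x) y
  have h2 : (J * D * J) x x = ∑ z, ∑ y, D z y := by
    simp only [hJ, Matrix.mul_apply, Matrix.of_apply, one_mul, mul_one]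
    exact Finset.sum_comm
  have h3 : (J * D) x x = ∑ y, D x y := by simp [hJ, Matrix.mul_apply, hS]
  have h4 : (D * J) x x = ∑ y, D x y := by simp [hJ, Matrix.mul_apply]
  have h5 : Q * D * Q = D - N⁻¹ • (J * D) - N⁻¹ • (D * J) + (N⁻¹ * N⁻¹) • (J * D * J) := by
    simp only [hQ, Matrix.sub_mul, Matrix.mul_sub, Matrix.smul_mul, Matrix.mul_smul,
      Matrix.one_mul, Matrix.mul_one, smul_sub, smul_smul]
    abel
  rw [hPM, hM, h5]
  simp only [Matrix.smul_apply, Matrix.sub_apply, Matrix.add_apply, smul_eq_mul, h2, h3, h4, hx]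
  field_simp
  ring

open Classical in
theorem SimpleGraph.lapMatrix_mul_apply_eq_sum {V : Type*} [Fintype V] (G : SimpleGraph V)
    (D : Matrix V V ℝ) (x y : V) :
    (G.lapMatrix ℝ * D) x y = ∑ z, if G.Adj x z then D x y - D z y else 0 := by
  have : (G.lapMatrix ℝ * D) x y = (G.lapMatrix ℝ).mulVec (fun z => D z y) x := rfl
  rw [this, SimpleGraph.lapMatrix_mulVec_apply, ← Finset.sum_filter,
    ← SimpleGraph.neighborFinset_eq_filter, Finset.sum_sub_distrib]
  simp

/-! ### The distance identity under one iteration -/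

section Step

variable {V : Type} {G : SimpleGraph V}

theorem sum_kochStep [Fintype V] [Fintype (PointedTriangle G)]
    [Fintype (V ⊕ (PointedTriangle G × Bool))] {M : Type*} [AddCommMonoid M]
    (F : V ⊕ (PointedTriangle G × Bool) → M) :
    ∑ x, F x = ∑ v, F (.inl v) + ∑ t, ∑ b, F (.inr (t, b)) := by
  rw [← Fintype.sum_prod_type' (f := fun t b => F (.inr (t, b)))]
  convert Fintype.sum_sum_type F

open Classical in
/-- Extension of a distance function on `G` to its Koch refinement. -/
noncomputable def kochStepDist (D : V → V → ℝ) :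
    V ⊕ (PointedTriangle G × Bool) → V ⊕ (PointedTriangle G × Bool) → ℝ
  | .inl u, .inl v => D u v
  | .inl u, .inr (t, _) => D u t.mother + 1
  | .inr (t, _), .inl v => D t.mother v + 1
  | .inr (t, b), .inr (t', b') =>
    if t = t' then (if b = b' then 0 else 1) else D t.mother t'.mother + 2

theorem kochStepDist_self {D : V → V → ℝ} (h : ∀ x, D x x = 0)
    (x : V ⊕ (PointedTriangle G × Bool)) : kochStepDist D x x = 0 := by
  rcases x with u | ⟨t, b⟩ <;> simp [kochStepDist, h]

theorem kochStepDist_comm {D : V → V → ℝ} (h : ∀ x y, D x y = D y x)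
    (x y : V ⊕ (PointedTriangle G × Bool)) : kochStepDist D x y = kochStepDist D y x := by
  rcases x with u | ⟨t, b⟩ <;> rcases y with v | ⟨t', b'⟩ <;>
    simp only [kochStepDist]
  · exact h _ _
  · rw [h]
  · rw [h]
  · by_cases ht : t = t'
    · simp [ht, eq_comm]
    · rw [if_neg ht, if_neg (Ne.symm ht), h]

/-- The equation `L D = a 1ᵀ - 3 I` in coordinates, for `L` the Laplacian of `G`
and `a = 3 - degree`. -/
def IsTriangularDist {W : Type*} [Fintype W] (H : SimpleGraph W) (D : W → W → ℝ) : Prop :=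
  open Classical in
  ∀ x y, (∑ z, if H.Adj x z then D x y - D z y + 1 else 0) = if x = y then 0 else 3

/-- New triangles hang on a single old vertex. Seen from their mother they contribute 0 unless y
lies among the two new nodes, when they contribute 2 + 1 = 3. -/
theorem IsTriangularDist.kochStep [Fintype V] [Fintype (V ⊕ (PointedTriangle G × Bool))]
    {D : V → V → ℝ} (h0 : ∀ x, D x x = 0) (hD : IsTriangularDist G D) :
    IsTriangularDist (kochStep G) (kochStepDist D) := by
  classical
  have : Fintype (PointedTriangle G) := Fintype.ofFinite _
  have a1 : ∀ u v, (_root_.kochStep G).Adj (.inl u) (.inl v) ↔ G.Adj u v := fun _ _ => Iff.rfl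
  have a2 : ∀ u t b, (_root_.kochStep G).Adj (.inl u) (.inr (t, b)) ↔ u = t.mother :=
    fun _ _ _ => Iff.rfl
  have a3 : ∀ u t b, (_root_.kochStep G).Adj (.inr (t, b)) (.inl u) ↔ u = t.mother :=
    fun _ _ _ => Iff.rfl
  have a4 : ∀ t b t' b', (_root_.kochStep G).Adj (.inr (t, b)) (.inr (t', b')) ↔
    (t = t' ∧ b ≠ b') := fun _ _ _ _ => Iff.rfl
  rintro (u | ⟨t, b⟩) y <;> rw [sum_kochStep]
  · simp only [a1, a2]
    rcases y with v | ⟨t', b'⟩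
    · simp only [kochStepDist]
      rw [Finset.sum_eq_zero (s := (Finset.univ : Finset (PointedTriangle G))), add_zero]
      · convert hD u v using 2; simp
      · intro t _
        refine Finset.sum_eq_zero fun b _ => ?_
        split_ifs with h
        · rw [h]; ring
        · rfl
    · simp only [kochStepDist]
      rw [Finset.sum_eq_single t']
      · have := hD u t'.mother
        simp only [add_sub_add_right_eq_sub, this, Fintype.sum_bool]
        by_cases h : u = t'.mother
        · cases b' <;> simp [h, h0] <;> norm_num
        · simp [h]
      · intro t _ ht
        refine Finset.sum_eq_zero fun b _ => ?_
        split_ifs with h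
        · rw [h]; ring
        · rfl
      · simp
  -- The only neighbours of a new node are its mother and its twin.
  · simp only [a3, a4, Finset.sum_ite_eq', Finset.mem_univ, if_true]
    rw [Finset.sum_eq_single t (fun t' _ ht => Finset.sum_eq_zero fun b' _ => if_neg
      fun h => ht h.1.symm) (by simp)]
    rcases y with v | ⟨t', b'⟩
    · cases b <;> simp [kochStepDist] <;> norm_num
    · by_cases ht : t = t'
      · subst ht
        cases b <;> cases b' <;> simp [kochStepDist, h0] <;> norm_num
      · cases b <;> simp [kochStepDist, ht] <;> ring

end Step
-- Triangles after one iteration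
section Triangles
variable {V : Type} {G : SimpleGraph V}

open Classical in
/-- The pointed triangles of the Koch refinement: the old ones, and for each pointed triangle of
`G` a new triangle, pointed at the mother (`none`) or at one of the two new nodes. -/
noncomputable def stepPointedTriangle :
    PointedTriangle G ⊕ (PointedTriangle G × Option Bool) → PointedTriangle (kochStep G)
  | .inl t => ⟨(t.1.1.map .inl, .inl t.1.2), by
      obtain ⟨⟨s, v⟩, hs, hv⟩ := t
      refine ⟨⟨?_, by simpa using hs.card_eq⟩, by simpa using hv⟩
      rintro _ hx _ hy hne
      simp only [Finset.coe_map, Set.mem_image] at hx hy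
      obtain ⟨x, hx, rfl⟩ := hx
      obtain ⟨y, hy, rfl⟩ := hy
      exact hs.isClique hx hy fun h => hne (by rw [h])⟩
  | .inr (t, o) => ⟨({.inl t.mother, .inr (t, false), .inr (t, true)},
      o.elim (.inl t.mother) fun b => .inr (t, b)), by
      refine ⟨SimpleGraph.is3Clique_triple_iff.2 ⟨rfl, rfl, rfl, by simp⟩, ?_⟩
      rcases o with _ | (_ | _) <;> simp⟩

/-- Surjectivity: a triangle with a new node lies in that node's closed neighbourhood, which has
just three elements; any other triangle is old. -/
theorem stepPointedTriangle_bijective :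
    Function.Bijective (stepPointedTriangle (G := G)) := by
  classical
  constructor
  · rintro (t | ⟨t, o⟩) (t' | ⟨t', o'⟩) h
    · have h1 := congrArg (fun p => p.1.1) h
      have h2 := congrArg (fun p => p.1.2) h
      simp only [stepPointedTriangle, Finset.map_inj, Sum.inl.injEq] at h1 h2
      exact congrArg _ (Subtype.ext (Prod.ext h1 h2))
    · have h1 := congrArg (fun p => Sum.inr (t', true) ∈ p.1.1) h
      simp [stepPointedTriangle] at h1
    · have h1 := congrArg (fun p => Sum.inr (t, true) ∈ p.1.1) h
      simp [stepPointedTriangle] at h1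
    · have h1 := congrArg (fun p => Sum.inr (t, true) ∈ p.1.1) h
      simp [stepPointedTriangle] at h1
      subst h1
      have h2 := congrArg (fun p => p.1.2) h
      rcases o with _ | b <;> rcases o' with _ | b' <;> simp [stepPointedTriangle] at h2 <;>
        simp [h2]
  · rintro ⟨⟨s, x⟩, hs, hx⟩
    by_cases hr : ∃ t b, Sum.inr (t, b) ∈ s
    · obtain ⟨t, b, hb⟩ := hr
      have hsub : s ⊆ {.inl t.mother, .inr (t, false), .inr (t, true)} := by
        intro y hy
        by_cases hyb : Sum.inr (t, b) = y
        · subst hyb; cases b <;> simp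
        have hadj : (kochStep G).Adj (.inr (t, b)) y := hs.isClique hb hy hyb
        rcases y with v | ⟨t', b'⟩
        · have : v = t.mother := hadj
          simp [this]
        · obtain ⟨rfl, -⟩ : t = t' ∧ b ≠ b' := hadj
          cases b' <;> simp
      have hseq := Finset.eq_of_subset_of_card_le hsub
        (by rw [hs.card_eq]; exact Finset.card_le_three)
      have hx' := hsub hx
      simp only [Finset.mem_insert, Finset.mem_singleton] at hx'
      rcases hx' with h | h | h
      exacts [⟨.inr (t, none), Subtype.ext (Prod.ext hseq.symm h.symm)⟩,
        ⟨.inr (t, some false), Subtype.ext (Prod.ext hseq.symm h.symm)⟩,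
        ⟨.inr (t, some true), Subtype.ext (Prod.ext hseq.symm h.symm)⟩]
    · push Not at hr
      obtain ⟨s', rfl⟩ : ∃ s' : Finset V, s = s'.map .inl := by
        refine ⟨s.toLeft, ?_⟩
        ext (v | ⟨t, b⟩)
        · simp
        · simp [hr]
      obtain ⟨v, hv, rfl⟩ := Finset.mem_map.1 hx
      refine ⟨.inl ⟨(s', v), ⟨?_, by simpa using hs.card_eq⟩, hv⟩, rfl⟩
      intro a ha b hb hne
      exact hs.isClique (Finset.mem_map_of_mem _ ha) (Finset.mem_map_of_mem _ hb)
        fun h => hne (Sum.inl.inj h)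

/-- The factor 2 counts the inherited pointed triangle and the new one pointed at the same mother.
-/
theorem sum_mother_kochStep [Fintype (PointedTriangle G)] [Fintype (PointedTriangle (kochStep G))]
    (F : V ⊕ (PointedTriangle G × Bool) → ℝ) :
    ∑ t : PointedTriangle (kochStep G), F t.mother =
      2 * ∑ t : PointedTriangle G, F (.inl t.mother) +
        ∑ t : PointedTriangle G, ∑ b, F (.inr (t, b)) := by
  rw [← stepPointedTriangle_bijective.sum_comp
    (fun t : PointedTriangle (kochStep G) => F t.mother), Fintype.sum_sum_type,
    Fintype.sum_prod_type, two_mul, add_assoc]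
  congr 1
  rw [← Finset.sum_add_distrib]
  refine Finset.sum_congr rfl fun t _ => ?_
  rw [Fintype.sum_option]
  rfl

end Triangles
-- Distance sums and the diagonal
section KochSums

noncomputable instance kochPointedTriangleFintype (g : ℕ) :
    Fintype (PointedTriangle (kochGraph g)) :=
  Fintype.ofFinite _

/-- A node of the Koch network, in the next network. -/
def kochOld {g : ℕ} (u : KochNode g) : KochNode (g + 1) := Sum.inl u

/-- A node created in passing to the next network. -/
def kochNew {g : ℕ} (t : PointedTriangle (kochGraph g)) (b : Bool) : KochNode (g + 1) :=
  Sum.inr (t, b)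

theorem kochNode_succ_cases {g : ℕ} (x : KochNode (g + 1)) :
    (∃ u, x = kochOld u) ∨ ∃ t b, x = kochNew t b :=
  match x with
  | .inl u => .inl ⟨u, rfl⟩
  | .inr (t, b) => .inr ⟨t, b, rfl⟩

theorem sum_kochNode_zero (F : KochNode 0 → ℝ) : ∑ x, F x = F (0 : Fin 3) + F (1 : Fin 3) +
    F (2 : Fin 3) := by
  -- The instance on `KochNode 0` comes from `Fintype.ofFinite`, hence the quantification over
  -- instances.
  have key : ∀ (inst : Fintype (Fin 3)) (f : Fin 3 → ℝ),
      (@Finset.univ _ inst).sum f = f 0 + f 1 + f 2 := by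
    intro inst f
    obtain rfl : inst = Fin.fintype 3 := Subsingleton.elim _ _
    exact Fin.sum_univ_three f
  exact key _ F

theorem sum_kochNode_succ {g : ℕ} (F : KochNode (g + 1) → ℝ) :
    ∑ x, F x = ∑ u, F (kochOld u) + ∑ t, ∑ b, F (kochNew t b) :=
  @sum_kochStep (KochNode g) (kochGraph g) _ _ (instFintypeKochNode (g + 1)) ℝ _ F

theorem sum_mother_zero (F : KochNode 0 → ℝ) :
    ∑ t : PointedTriangle (kochGraph 0), F t.mother = ∑ x, F x := by
  refine Fintype.sum_bijective PointedTriangle.mother ⟨?_, fun x => ?_⟩ _ _ fun _ => rfl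
  · rintro ⟨⟨s, v⟩, hs, hv⟩ ⟨⟨s', v'⟩, hs', hv'⟩ (rfl : v = v')
    have key : ∀ r : Finset (KochNode 0), r.card = 3 → r = Finset.univ := fun r hr =>
      Finset.eq_univ_of_card r (by
        rw [hr, Fintype.card_eq_nat_card]; exact (Nat.card_fin 3).symm)
    obtain rfl := (key s hs.card_eq).trans (key s' hs'.card_eq).symm
    rfl
  · refine ⟨⟨((Finset.univ : Finset (Fin 3)), x), ⟨fun a _ b _ h => h, rfl⟩, ?_⟩, rfl⟩
    exact Finset.mem_univ (α := Fin 3) x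

theorem sum_mother_succ {g : ℕ} (F : KochNode (g + 1) → ℝ) :
    ∑ t : PointedTriangle (kochGraph (g + 1)), F t.mother =
      2 * ∑ t : PointedTriangle (kochGraph g), F (kochOld t.mother) +
        ∑ t : PointedTriangle (kochGraph g), ∑ b, F (kochNew t b) :=
  @sum_mother_kochStep (KochNode g) (kochGraph g) _
    (kochPointedTriangleFintype (g + 1)) F

theorem card_pointedTriangle_kochGraph (g : ℕ) :
    (Fintype.card (PointedTriangle (kochGraph g)) : ℝ) = 3 * 4 ^ g := by
  induction g with
  | zero =>
    have := sum_mother_zero fun _ => 1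
    rw [sum_kochNode_zero] at this
    simp only [Finset.sum_const, Finset.card_univ, nsmul_eq_mul, mul_one] at this
    rw [this]; norm_num
  | succ g ih =>
    have := sum_mother_succ (g := g) fun _ => 1
    simp only [Finset.sum_const, Finset.card_univ, nsmul_eq_mul, mul_one, ih,
      Fintype.card_bool] at this
    rw [this]; push_cast; ring

theorem card_kochNode (g : ℕ) : (Fintype.card (KochNode g) : ℝ) = 2 * 4 ^ g + 1 := by
  induction g with
  | zero =>
    have := sum_kochNode_zero fun _ => 1
    simp only [Finset.sum_const, Finset.card_univ, nsmul_eq_mul, mul_one] at this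
    rw [this]; norm_num
  | succ g ih =>
    have := sum_kochNode_succ (g := g) fun _ => 1
    simp only [Finset.sum_const, Finset.card_univ, nsmul_eq_mul, mul_one, ih,
      Fintype.card_bool, card_pointedTriangle_kochGraph] at this
    rw [this]; push_cast; ring

/-- The distance function of a triangle. -/
def triangleDist (x y : Fin 3) : ℝ := if x = y then 0 else 1

theorem sum_triangleDist (x : Fin 3) :
    triangleDist x 0 + triangleDist x 1 + triangleDist x 2 = 2 := by
  fin_cases x <;> simp [triangleDist] <;> norm_num

theorem isTriangularDist_triangleDist [inst : Fintype (Fin 3)] :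
    IsTriangularDist (⊤ : SimpleGraph (Fin 3)) triangleDist := by
  obtain rfl : inst = Fin.fintype 3 := Subsingleton.elim _ _
  intro x y
  rw [Fin.sum_univ_three]
  fin_cases x <;> fin_cases y <;> simp [triangleDist] <;> norm_num

/-- The distance function of the Koch network. -/
noncomputable def kochDist : (g : ℕ) → KochNode g → KochNode g → ℝ
  | 0 => triangleDist
  | g + 1 => kochStepDist (kochDist g)

/-- The excess of the distance sum of a node over that of a hub. -/
noncomputable def kochExcess : (g : ℕ) → KochNode g → ℝ
  | 0, _ => 0
  | g + 1, x => Sum.elim (fun u => 4 * kochExcess g u)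
      (fun p => 4 * kochExcess g p.1.mother + 2 * 4 ^ (g + 1) - 2) x

variable {g : ℕ}

theorem kochExcess_old (u : KochNode g) :
    kochExcess (g + 1) (kochOld u) = 4 * kochExcess g u := rfl

theorem kochExcess_new (t : PointedTriangle (kochGraph g)) (b : Bool) :
    kochExcess (g + 1) (kochNew t b) = 4 * kochExcess g t.mother + 2 * 4 ^ (g + 1) - 2 := rfl

theorem kochDist_old_old (u v : KochNode g) :
    kochDist (g + 1) (kochOld u) (kochOld v) = kochDist g u v := rfl

theorem kochDist_old_new (u : KochNode g) (t : PointedTriangle (kochGraph g)) (b : Bool) :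
    kochDist (g + 1) (kochOld u) (kochNew t b) = kochDist g u t.mother + 1 := rfl

theorem kochDist_new_old (v : KochNode g) (t : PointedTriangle (kochGraph g)) (b : Bool) :
    kochDist (g + 1) (kochNew t b) (kochOld v) = kochDist g t.mother v + 1 := rfl

open Classical in
theorem kochDist_new_new (t t' : PointedTriangle (kochGraph g)) (b b' : Bool) :
    kochDist (g + 1) (kochNew t b) (kochNew t' b') =
      if t = t' then (if b = b' then 0 else 1) else kochDist g t.mother t'.mother + 2 := rfl

theorem kochDist_self (g : ℕ) (x : KochNode g) : kochDist g x x = 0 := by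
  induction g with
  | zero => exact if_pos rfl
  | succ g ih => exact kochStepDist_self ih x

theorem kochDist_comm (g : ℕ) (x y : KochNode g) : kochDist g x y = kochDist g y x := by
  induction g with
  | zero => change Fin 3 at x y; simp [kochDist, triangleDist, eq_comm]
  | succ g ih => exact kochStepDist_comm ih x y

theorem isTriangularDist_kochDist (g : ℕ) : IsTriangularDist (kochGraph g) (kochDist g) := by
  classical
  induction g with
  | zero => exact @isTriangularDist_triangleDist (instFintypeKochNode 0)
  | succ g ih =>
    exact @IsTriangularDist.kochStep (KochNode g) (kochGraph g) _ (instFintypeKochNode (g + 1)) _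
      (kochDist_self g) ih

/-- The sum of the distances from a new node to all new nodes, in terms of its mother. -/
theorem sum_kochDist_new_new (t : PointedTriangle (kochGraph g)) (b : Bool) :
    ∑ t', ∑ b', kochDist (g + 1) (kochNew t b) (kochNew t' b') =
      2 * ∑ t' : PointedTriangle (kochGraph g), kochDist g t.mother t'.mother + 12 * 4 ^ g - 3 := by
  classical
  -- For t = t' the generic value is 4 while the true sum is 0 + 1; hence the correction 3.
  have : ∀ t', ∑ b', kochDist (g + 1) (kochNew t b) (kochNew t' b') =
      2 * kochDist g t.mother t'.mother + 4 - if t = t' then 3 else 0 := by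
    intro t'
    by_cases h : t = t'
    · subst h
      cases b <;> simp [kochDist_new_new, kochDist_self] <;> norm_num
    · simp [kochDist_new_new, h]; ring
  simp only [this, Finset.sum_sub_distrib, Finset.sum_add_distrib, ← Finset.mul_sum,
    Finset.sum_ite_eq, Finset.mem_univ, if_true, Finset.sum_const, Finset.card_univ, nsmul_eq_mul,
    card_pointedTriangle_kochGraph]
  ring

/-- Sums over new nodes weight each old node by its number of triangles. This weighted sum obeys a
closed recursion, which then feeds the one for the plain sum. -/
theorem sum_kochDist_mother (g : ℕ) (u : KochNode g) :
    ∑ t : PointedTriangle (kochGraph g), kochDist g u t.mother =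
      4 ^ g * (2 + 3 / 2 * g) + 3 / 2 * kochExcess g u := by
  induction g with
  | zero =>
    rw [sum_mother_zero, sum_kochNode_zero]
    refine (sum_triangleDist u).trans ?_
    simp [kochExcess]
  | succ g ih =>
    rw [sum_mother_succ]
    rcases kochNode_succ_cases u with ⟨u, rfl⟩ | ⟨t, b, rfl⟩
    · simp only [kochDist_old_old, kochDist_old_new, Finset.sum_add_distrib, Finset.sum_const,
        Finset.card_univ, nsmul_eq_mul, Fintype.card_bool, card_pointedTriangle_kochGraph,
        ← Finset.mul_sum, ih, kochExcess_old]
      push_cast; ring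
    · simp only [sum_kochDist_new_new, kochDist_new_old, Finset.sum_add_distrib, Finset.sum_const,
        Finset.card_univ, nsmul_eq_mul, card_pointedTriangle_kochGraph, ih, kochExcess_new]
      push_cast; ring

/-- For old nodes the excess e becomes e + 2·(3/2)e = 4e. A new node is 1 farther than its mother
from all nodes but itself (1 nearer) and its twin (equal), which adds 2·4^(g+1) - 2. -/
theorem sum_kochDist (g : ℕ) (u : KochNode g) :
    ∑ y, kochDist g u y = 4 ^ g * (g + 2) + kochExcess g u := by
  induction g with
  | zero =>
    rw [sum_kochNode_zero]
    refine (sum_triangleDist u).trans ?_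
    simp [kochExcess]
  | succ g ih =>
    rw [sum_kochNode_succ]
    rcases kochNode_succ_cases u with ⟨u, rfl⟩ | ⟨t, b, rfl⟩
    · simp only [kochDist_old_old, kochDist_old_new, Finset.sum_add_distrib, Finset.sum_const,
        Finset.card_univ, nsmul_eq_mul, Fintype.card_bool, card_pointedTriangle_kochGraph,
        ← Finset.mul_sum, ih, kochExcess_old, sum_kochDist_mother]
      push_cast; ring
    · simp only [sum_kochDist_new_new, kochDist_new_old, Finset.sum_add_distrib, Finset.sum_const,
        Finset.card_univ, nsmul_eq_mul, card_kochNode, ih, kochExcess_new, sum_kochDist_mother]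
      push_cast; ring

theorem sum_kochExcess_mother (g : ℕ) :
    ∑ t : PointedTriangle (kochGraph g), kochExcess g t.mother =
      3 * g * (4 ^ g) ^ 2 + 4 ^ g - (4 ^ g) ^ 2 := by
  induction g with
  | zero => simp [kochExcess]
  | succ g ih =>
    rw [sum_mother_succ]
    simp only [kochExcess_old, kochExcess_new, Finset.sum_add_distrib, Finset.sum_sub_distrib,
      Finset.sum_const, Finset.card_univ, nsmul_eq_mul, Fintype.card_bool,
      card_pointedTriangle_kochGraph, ← Finset.mul_sum, ih]
    push_cast; ring

/-- Arranged so that the multiples of g + 2 cancel in the diagonal formula, leaving its constant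
term. -/
theorem sum_kochExcess (g : ℕ) :
    ∑ u, kochExcess g u =
      4 ^ g * ((2 * 4 ^ g + 1) * (g + 2) - (10 * 4 ^ g + 6 * g + 8) / 3) := by
  induction g with
  | zero => simp [kochExcess]; norm_num
  | succ g ih =>
    rw [sum_kochNode_succ]
    simp only [kochExcess_old, kochExcess_new, Finset.sum_add_distrib, Finset.sum_sub_distrib,
      Finset.sum_const, Finset.card_univ, nsmul_eq_mul, Fintype.card_bool,
      card_pointedTriangle_kochGraph, ← Finset.mul_sum, ih, sum_kochExcess_mother]
    push_cast; ring

theorem kochLapPinv_diag (g : ℕ) (x : KochNode g) :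
    kochLapPinv g x x = 2 / (3 * (2 * (4 : ℝ) ^ g + 1)) * kochExcess g x +
      2 ^ (2 * g + 1) * (5 * 4 ^ g + 3 * (g : ℝ) + 4) / (9 * (2 * (4 : ℝ) ^ g + 1) ^ 2) := by
  classical
  have h := (pseudoInverse_spec ((kochGraph g).lapMatrix ℝ)
    ((kochGraph g).isHermitian_lapMatrix ℝ)).diag_eq_of_mul_eq (D := Matrix.of (kochDist g))
    (a := fun x => 3 - ∑ z, if (kochGraph g).Adj x z then (1 : ℝ) else 0)
    ((kochGraph g).isSymm_lapMatrix (R := ℝ)) (fun x => ?_)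
    (Matrix.ext fun x y => kochDist_comm g y x) (fun x y => ?_) x (kochDist_self g x)
  · have h' : kochLapPinv g x x = pseudoInverse ((kochGraph g).lapMatrix ℝ)
        ((kochGraph g).isHermitian_lapMatrix ℝ) x x := by
      unfold kochLapPinv; congr!
    rw [h', h]
    have hN : 2 * (4 : ℝ) ^ g + 1 ≠ 0 := by positivity
    have h2 : (2 : ℝ) ^ (2 * g + 1) = 2 * 4 ^ g := by rw [pow_succ, pow_mul]; norm_num; ring
    simp only [Matrix.of_apply, sum_kochDist, card_kochNode, Finset.sum_add_distrib,
      Finset.sum_const, Finset.card_univ, nsmul_eq_mul, sum_kochExcess, h2]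
    field_simp
    ring
  · have := congrFun ((kochGraph g).lapMatrix_mulVec_const_eq_zero (R := ℝ)) x
    simpa [Matrix.mulVec, dotProduct] using this
  · rw [SimpleGraph.lapMatrix_mul_apply_eq_sum]
    have := isTriangularDist_kochDist g x y
    have h3 : ∀ z, (if (kochGraph g).Adj x z then kochDist g x y - kochDist g z y + 1 else 0) =
        (if (kochGraph g).Adj x z then kochDist g x y - kochDist g z y else 0) +
        (if (kochGraph g).Adj x z then (1 : ℝ) else 0) := by
      intro z; split_ifs <;> simp
    simp only [h3, Finset.sum_add_distrib] at this
    simp only [Matrix.of_apply]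
    split_ifs at this ⊢ <;> linarith

end KochSums
-- Depth, levels and labels
section KochLabels

/-- The number of passages to the mother that lead from a node to a hub. -/
def kochDepth : (g : ℕ) → KochNode g → ℕ
  | 0, _ => 0
  | g + 1, x => Sum.elim (kochDepth g) (fun p => kochDepth g p.1.mother + 1) x

theorem kochDepth_and_kochExcess_of_hub (g : ℕ) (x : KochNode g) (hx : kochLevel g x = 0) :
    kochDepth g x = 0 ∧ kochExcess g x = 0 := by
  induction g with
  | zero => exact ⟨rfl, rfl⟩
  | succ g ih =>
    rcases kochNode_succ_cases x with ⟨u, rfl⟩ | ⟨t, b, rfl⟩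
    · obtain ⟨h1, h2⟩ := ih u hx
      exact ⟨h1, by rw [kochExcess_old, h2, mul_zero]⟩
    · exact absurd hx (Nat.succ_ne_zero g)

theorem exists_walk_length_eq_kochDepth (g : ℕ) (x : KochNode g) :
    ∃ (h : KochNode g) (p : (kochGraph g).Walk h x),
      kochLevel g h = 0 ∧ p.length = kochDepth g x := by
  induction g with
  | zero => exact ⟨x, .nil, rfl, rfl⟩
  | succ g ih =>
    let f : kochGraph g →g kochGraph (g + 1) := ⟨Sum.inl, fun {_ _} h => h⟩
    rcases kochNode_succ_cases x with ⟨u, rfl⟩ | ⟨t, b, rfl⟩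
    · obtain ⟨h, p, h0, hp⟩ := ih u
      exact ⟨f h, p.map f, h0, (SimpleGraph.Walk.length_map f p).trans hp⟩
    · obtain ⟨h, p, h0, hp⟩ := ih t.mother
      have hadj : (kochGraph (g + 1)).Adj (f t.mother) (kochNew t b) :=
        (rfl : t.mother = t.mother)
      exact ⟨f h, (p.map f).concat hadj, h0, by
        rw [SimpleGraph.Walk.length_concat, SimpleGraph.Walk.length_map, hp]; rfl⟩

/-- Along an edge the depth grows by at most one, and when it grows, the excess changes by an
amount that depends on the level of the endpoint only. -/
theorem kochDepth_le_and_kochExcess_of_adj (g : ℕ) {x y : KochNode g}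
    (h : (kochGraph g).Adj x y) :
    kochDepth g y ≤ kochDepth g x + 1 ∧ (kochDepth g y = kochDepth g x + 1 →
      kochExcess g y = kochExcess g x + 2 * 4 ^ g -
        2 * (4 : ℝ) ^ ((g : ℤ) - (kochLevel g y : ℤ))) := by
  induction g with
  | zero => exact ⟨Nat.zero_le _, fun h => absurd h (by simp [kochDepth])⟩
  | succ g ih =>
    have hold : ∀ u : KochNode g, kochDepth (g + 1) (kochOld u) = kochDepth g u := fun _ => rfl
    have hnew : ∀ (t : PointedTriangle (kochGraph g)) b,
      kochDepth (g + 1) (kochNew t b) = kochDepth g t.mother + 1 := fun _ _ => rfl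
    rcases kochNode_succ_cases x with ⟨u, rfl⟩ | ⟨t, b, rfl⟩ <;>
      rcases kochNode_succ_cases y with ⟨v, rfl⟩ | ⟨t', b', rfl⟩
    · obtain ⟨h1, h2⟩ := ih (x := u) (y := v) h
      refine ⟨h1, fun hd => ?_⟩
      have hl : kochLevel (g + 1) (kochOld v) = kochLevel g v := rfl
      -- An iteration multiplies the excess of old nodes by 4 and keeps their levels, so every term
      -- scales by 4.
      have hz : (4 : ℝ) ^ (((g + 1 : ℕ) : ℤ) - (kochLevel g v : ℤ)) =
          4 ^ ((g : ℤ) - (kochLevel g v : ℤ)) * 4 := by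
        rw [Nat.cast_succ, add_sub_right_comm, zpow_add_one₀ (by norm_num)]
      rw [kochExcess_old, kochExcess_old, h2 hd, hl, hz]
      ring
    · obtain rfl : u = t'.mother := h
      have hl : kochLevel (g + 1) (kochNew t' b') = g + 1 := rfl
      refine ⟨le_rfl, fun _ => ?_⟩
      rw [kochExcess_old, kochExcess_new, hl, sub_self, zpow_zero, mul_one]
    · obtain rfl : v = t.mother := h
      rw [hold, hnew]
      exact ⟨by omega, fun h => by omega⟩
    · obtain ⟨rfl, -⟩ : t = t' ∧ b ≠ b' := h
      rw [hnew, hnew]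
      exact ⟨by omega, fun h => by omega⟩

/-- If the depth grows by the full length of the walk, it grows on every edge, so the edge
increments add up. -/
theorem kochDepth_le_and_kochExcess_of_walk (g : ℕ) {x y : KochNode g}
    (p : (kochGraph g).Walk x y) :
    kochDepth g y ≤ kochDepth g x + p.length ∧ (kochDepth g y = kochDepth g x + p.length →
      kochExcess g y = kochExcess g x + 2 * p.length * 4 ^ g -
        ∑ k ∈ Finset.range p.length,
          2 * (4 : ℝ) ^ ((g : ℤ) - (kochLevel g (p.getVert (k + 1)) : ℤ))) := by
  induction p with
  | nil => simp
  | cons h p ih =>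
    obtain ⟨h1, h2⟩ := kochDepth_le_and_kochExcess_of_adj g h
    obtain ⟨h3, h4⟩ := ih
    rw [SimpleGraph.Walk.length_cons]
    refine ⟨by omega, fun hd => ?_⟩
    rw [h4 (by omega), h2 (by omega), Finset.sum_range_succ']
    simp only [SimpleGraph.Walk.getVert_cons_succ, SimpleGraph.Walk.getVert_zero]
    push_cast
    ring

end KochLabels

theorem mainTheorem2 (g : ℕ) (x : KochNode g) (n : ℕ) (i : Fin (n + 1) → ℕ)
    (hx : IsKochLabel g x i) :
    kochLapPinv g x x =
      2 / (3 * (2 * (4 : ℝ) ^ g + 1)) *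
          (2 * (n : ℝ) * 4 ^ g - ∑ k : Fin n, 2 * (4 : ℝ) ^ ((g : ℤ) - (i k.succ : ℤ))) +
        2 ^ (2 * g + 1) * (5 * 4 ^ g + 3 * (g : ℝ) + 4) /
          (9 * (2 * (4 : ℝ) ^ g + 1) ^ 2) := by
  obtain ⟨h, p, h0, rfl, hmin, hi⟩ := hx
  obtain ⟨hd, he⟩ := kochDepth_and_kochExcess_of_hub g h h0
  obtain ⟨h1, h2⟩ := kochDepth_le_and_kochExcess_of_walk g p
  obtain ⟨h', q, h0', hq⟩ := exists_walk_length_eq_kochDepth g x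
  have hle := hmin h' q h0'
  -- The bounds `h1`, `hle` and `hq` force the length of `p` to equal the depth of x, the equality
  -- case of the walk lemma.
  rw [kochLapPinv_diag, h2 (by omega), he, zero_add, Finset.sum_range]
  simp only [← hi, Fin.val_succ]
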